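/- Let $\alpha>\frac12$ be a real number. There exist an integer $N_0$ and a real constant $C$, both depending only on $\alpha$, such that the following holds. Let $G$ be a finite simple graph with $n\ge N_0$ vertices, and let $c:E(G)\to\mathbb N$ be an edge coloring (not necessarily proper) in which exactly $n$ colors occur, so that $E(G)$ is partitioned into $n$ nonempty color classes $F_i=\{e\in E(G): c(e)=i\}$. Suppose that at least $\alpha n$ of the color classes are each either a matching of size $2$ (exactly two edges, with no common vertex) or a triangle (exactly the three edges of a triangle); the remaining color classes are arbitrary. Then $G$ contains a rainbow cycle, that is, a cycle whose edges have pairwise distinct colors, of length at most $C\log_2 n$. -/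

import Mathlib

namespace SimpleGraph.EdgeLabeling

/-- The set of colors that occur on the edges of an edge-colored graph. They are in bijection with
the (nonempty) color classes, which partition `E(G)`. -/
def colors {V : Type*} {G : SimpleGraph V} (c : G.EdgeLabeling ℕ) : Set ℕ :=
  Set.range (fun e : G.edgeSet => c e)

/-- The color class of color `i`, as a set of edges. -/
def colorClass {V : Type*} {G : SimpleGraph V} (c : G.EdgeLabeling ℕ) (i : ℕ) : Set (Sym2 V) :=
  {e | ∃ h : e ∈ G.edgeSet, c ⟨e, h⟩ = i}

/-- A subgraph is rainbow if its distinct edges have distinct colors. -/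
def IsRainbow {V : Type*} {G : SimpleGraph V} (c : G.EdgeLabeling ℕ) (H : G.Subgraph) : Prop :=
  ∀ e f : G.edgeSet, (e : Sym2 V) ∈ H.edgeSet → (f : Sym2 V) ∈ H.edgeSet → e ≠ f → c e ≠ c f

end SimpleGraph.EdgeLabeling

/-- The edge set `F` consists of exactly two edges, and these have no common vertex. -/
def IsTwoMatching {V : Type*} (F : Set (Sym2 V)) : Prop :=
  ∃ a b x y : V, a ≠ b ∧ x ≠ y ∧ a ≠ x ∧ a ≠ y ∧ b ≠ x ∧ b ≠ y ∧ F = {s(a, b), s(x, y)}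

/-- The edge set `F` consists of exactly the three edges of a triangle. -/
def IsTriangleEdgeSet {V : Type*} (F : Set (Sym2 V)) : Prop :=
  ∃ a b d : V, a ≠ b ∧ a ≠ d ∧ b ≠ d ∧ F = {s(a, b), s(b, d), s(a, d)}

/-! The plan is to pick one edge of each color so that a set `W` of at least `δ n` vertices is
missed. These `n` edges then live on at most `(1 - δ) n` vertices. A graph with that surplus of
edges has a cycle of length `O(log n)`, which is rainbow because each color was used once.
Representatives of the at most `(1 - α) n` unrestricted colors touch at most `2 (1 - α) n` vertices,
which leaves at least `(2 α - 1) n` untouched; this is where `α > 1/2` enters. Among those, a greedy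
choice gives a linear-sized `W` meeting each special class in at most one vertex
(`exists_subset_forall_inter_subsingleton`). No vertex covers a two-matching or a triangle, so each
special class has an edge off `W`. The short cycle comes from a minimal dense vertex set: balls in
it grow by a factor `1 + δ` until one closes a cycle (`exists_isCycle_or_pow_le_card`). -/

namespace SimpleGraph

/-! ### Logarithmic cycles in dense graphs -/

variable {V : Type*}

/-- If a set `B` of vertices at distance at most `r` from `v` spans at least `|B|` edges, then one of
them lies outside a breadth-first search tree, and closes a cycle of length at most `2 r + 1`. -/
theorem exists_isCycle_length_le_of_card_le (H : SimpleGraph V) (v : V) (r : ℕ) (B : Finset V)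
    (hv : v ∈ B) (hB : ∀ u ∈ B, H.Reachable v u ∧ H.dist v u ≤ r) (F : Finset (Sym2 V))
    (hF : ∀ e ∈ F, e ∈ H.edgeSet ∧ ∀ u ∈ e, u ∈ B) (hc : B.card ≤ F.card) :
    ∃ (x : V) (w : H.Walk x x), w.IsCycle ∧ w.length ≤ 2 * r + 1 := by
  classical
  have parent : ∀ u, H.Reachable v u ∧ u ≠ v →
      ∃ p, H.Adj u p ∧ H.Reachable v p ∧ H.dist v p + 1 ≤ H.dist v u := by
    rintro u ⟨hu, huv⟩
    obtain ⟨w, hw⟩ := hu.symm.exists_walk_length_eq_dist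
    cases w with
    | nil => exact absurd rfl huv
    | cons h q =>
      refine ⟨_, h, q.reachable.symm, ?_⟩
      rw [dist_comm (u := v) (v := u), ← hw, Walk.length_cons, dist_comm]
      exact Nat.succ_le_succ (dist_le q)
  choose! p hadj hreach hdist using parent
  let T : SimpleGraph V := fromEdgeSet {e | ∃ u, (H.Reachable v u ∧ u ≠ v) ∧ e = s(u, p u)}
  have hTH : T ≤ H := by
    intro a b hab
    obtain ⟨⟨u, hu, he⟩, -⟩ := (fromEdgeSet_adj _).1 hab
    rw [← mem_edgeSet, he]
    exact hadj u hu
  have walks : ∀ k u, H.Reachable v u → H.dist v u ≤ k → ∃ w : T.Walk v u, w.length ≤ k := by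
    intro k
    induction k with
    | zero =>
      intro u hu hd
      obtain rfl := hu.dist_eq_zero_iff.1 (Nat.le_zero.1 hd)
      exact ⟨Walk.nil, le_rfl⟩
    | succ k ih =>
      intro u hu hd
      by_cases huv : u = v
      · subst huv
        exact ⟨Walk.nil, Nat.zero_le _⟩
      · have h1 := hdist u ⟨hu, huv⟩
        obtain ⟨w, hw⟩ := ih (p u) (hreach u ⟨hu, huv⟩) (by omega)
        have hTadj : T.Adj (p u) u :=
          (fromEdgeSet_adj _).2 ⟨⟨u, ⟨hu, huv⟩, Sym2.eq_swap⟩, (hadj u ⟨hu, huv⟩).ne'⟩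
        exact ⟨w.concat hTadj, by rw [Walk.length_concat]; omega⟩
  obtain ⟨e, heF, heT⟩ : ∃ e ∈ F, e ∉ T.edgeSet := by
    by_contra! hall
    -- A tree edge is the parent edge of some non-root vertex, so at most `|B| - 1` of them lie in
    -- `F`.
    have hsub : F ⊆ (B.erase v).image fun u => s(u, p u) := by
      intro e he
      have heT := hall e he
      rw [edgeSet_fromEdgeSet] at heT
      obtain ⟨⟨u, hu, rfl⟩, -⟩ := heT
      exact Finset.mem_image.2
        ⟨u, Finset.mem_erase.2 ⟨hu.2, (hF _ he).2 u (Sym2.mem_mk_left _ _)⟩, rfl⟩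
    have h1 := (Finset.card_le_card hsub).trans Finset.card_image_le
    have h2 := Finset.card_erase_lt_of_mem hv
    omega
  obtain ⟨heH, heB⟩ := hF e heF
  induction e with
  | h x y =>
    obtain ⟨hx, hxd⟩ := hB x (heB x (Sym2.mem_mk_left _ _))
    obtain ⟨hy, hyd⟩ := hB y (heB y (Sym2.mem_mk_right _ _))
    obtain ⟨w₁, hw₁⟩ := walks r x hx hxd
    obtain ⟨w₂, hw₂⟩ := walks r y hy hyd
    let q := (w₂.reverse.append w₁).bypass
    have hq : q.length ≤ 2 * r := by
      refine (Walk.length_bypass_le_length _).trans ?_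
      rw [Walk.length_append, Walk.length_reverse]
      omega
    have hxy : H.Adj x y := heH
    refine ⟨x, Walk.cons hxy (q.mapLe hTH), ?_, ?_⟩
    · rw [Walk.cons_isCycle_iff]
      refine ⟨(Walk.isPath_mapLe hTH).2 (Walk.bypass_isPath _), fun hmem => heT ?_⟩
      rw [Walk.edges_mapLe_eq_edges] at hmem
      exact q.edges_subset_edgeSet hmem
    · simpa using hq

/-- The edges of `H` inside the vertex set `S`. -/
noncomputable def edgesWithin [Fintype V] (H : SimpleGraph V) (S : Finset V) : Finset (Sym2 V) := by
  classical exact Finset.univ.filter fun e => e ∈ H.edgeSet ∧ ∀ u ∈ e, u ∈ S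

theorem mem_edgesWithin [Fintype V] {H : SimpleGraph V} {S : Finset V} {e : Sym2 V} :
    e ∈ H.edgesWithin S ↔ e ∈ H.edgeSet ∧ ∀ u ∈ e, u ∈ S := by
  simp [edgesWithin]

/-- Minimality is what drives expansion: removing any nonempty subset `T` from `S'` destroys at
least `(1 + δ)|T|` edges. -/
theorem exists_minimal_dense [Fintype V] (H : SimpleGraph V) (δ : ℝ) (S : Finset V)
    (hS : S.Nonempty) (hd : (1 + δ) * S.card ≤ (H.edgesWithin S).card) :
    ∃ S' : Finset V, S'.Nonempty ∧ (1 + δ) * S'.card ≤ (H.edgesWithin S').card ∧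
      ∀ T ⊂ S', ((H.edgesWithin T).card : ℝ) ≤ (1 + δ) * T.card := by
  induction S using Finset.strongInduction with
  | H S ih =>
    by_cases h : ∃ T ⊂ S, T.Nonempty ∧ (1 + δ) * T.card ≤ ((H.edgesWithin T).card : ℝ)
    · obtain ⟨T, hT, hne, hdT⟩ := h
      exact ih T hT hne hdT
    · push Not at h
      refine ⟨S, hS, hd, fun T hT => ?_⟩
      rcases T.eq_empty_or_nonempty with rfl | hne
      · have : H.edgesWithin ∅ = ∅ := by
          refine Finset.eq_empty_of_forall_notMem fun e he => ?_
          have := (mem_edgesWithin.1 he).2 _ e.out_fst_mem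
          simp at this
        simp [this]
      · exact (h T hT hne).le

/-- A dense graph has, around each vertex of a minimal dense set, either a short cycle or balls that
grow exponentially. -/
theorem exists_isCycle_or_pow_le_card [Fintype V] (H : SimpleGraph V) {δ : ℝ} (hδ : 0 < δ)
    (S : Finset V) (hS : S.Nonempty) (hd : (1 + δ) * S.card ≤ (H.edgesWithin S).card) (r : ℕ) :
    (∃ (x : V) (w : H.Walk x x), w.IsCycle ∧ w.length ≤ 2 * r + 1) ∨
      (1 + δ) ^ r ≤ (Fintype.card V : ℝ) := by
  classical
  obtain ⟨S, ⟨v, hv⟩, hd, hmin⟩ := H.exists_minimal_dense δ S hS hd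
  let K : SimpleGraph V := fromEdgeSet (H.edgesWithin S : Set (Sym2 V))
  have hKH : K ≤ H := by
    intro a b hab
    exact (mem_edgesWithin.1 ((fromEdgeSet_adj _).1 hab).1).1
  have hKe : ∀ e ∈ H.edgesWithin S, e ∈ K.edgeSet := by
    intro e he
    rw [edgeSet_fromEdgeSet]
    exact ⟨he, H.not_isDiag_of_mem_edgeSet (mem_edgesWithin.1 he).1⟩
  let ball : ℕ → Finset V := fun k => S.filter fun u => K.Reachable v u ∧ K.dist v u ≤ k
  have hvb : ∀ k, v ∈ ball k := fun k => by simp [ball, hv]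
  have key : ∀ k, (∃ (x : V) (w : H.Walk x x), w.IsCycle ∧ w.length ≤ 2 * k + 1) ∨
      (1 + δ) ^ k ≤ ((ball k).card : ℝ) := by
    intro k
    induction k with
    | zero =>
      right
      have : 1 ≤ (ball 0).card := Finset.card_pos.2 ⟨v, hvb 0⟩
      simpa using this
    | succ k ih =>
      rcases ih with ⟨x, w, hw, hl⟩ | hk
      · exact Or.inl ⟨x, w, hw, by omega⟩
      -- The edges touching the ball of radius `k`; they all lie in the next ball. If that ball has
      -- no more vertices than these edges, a cycle closes; otherwise it is larger by the factor `1
      -- + δ`.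
      let F := H.edgesWithin S \ H.edgesWithin (S \ ball k)
      have hball : ball k ⊆ S := Finset.filter_subset _ _
      have hFcard : (1 + δ) * (ball k).card ≤ (F.card : ℝ) := by
        have hsub : H.edgesWithin (S \ ball k) ⊆ H.edgesWithin S := fun e he =>
          mem_edgesWithin.2 ⟨(mem_edgesWithin.1 he).1,
            fun u hu => (Finset.mem_sdiff.1 ((mem_edgesWithin.1 he).2 u hu)).1⟩
        have h1 : F.card + (H.edgesWithin (S \ ball k)).card = (H.edgesWithin S).card :=
          Finset.card_sdiff_add_card_eq_card hsub
        have h2 : (S \ ball k).card + (ball k).card = S.card :=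
          Finset.card_sdiff_add_card_eq_card hball
        have h3 := hmin (S \ ball k) (Finset.sdiff_ssubset hball ⟨v, hvb k⟩)
        rw [← h1, ← h2] at hd
        push_cast at hd
        linarith
      have hF : ∀ e ∈ F, e ∈ K.edgeSet ∧ ∀ u ∈ e, u ∈ ball (k + 1) := by
        intro e he
        obtain ⟨heS, heT⟩ := Finset.mem_sdiff.1 he
        have heK := hKe e heS
        refine ⟨heK, fun u hu => ?_⟩
        obtain ⟨heH, heS'⟩ := mem_edgesWithin.1 heS
        obtain ⟨x, hxe, hx⟩ : ∃ x ∈ e, x ∈ ball k := by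
          by_contra! hno
          exact heT (mem_edgesWithin.2
            ⟨heH, fun x hx => Finset.mem_sdiff.2 ⟨heS' x hx, hno x hx⟩⟩)
        obtain ⟨-, hxr, hxd⟩ := Finset.mem_filter.1 hx
        refine Finset.mem_filter.2 ⟨heS' u hu, ?_⟩
        by_cases hux : u = x
        · subst hux
          exact ⟨hxr, hxd.trans (Nat.le_succ k)⟩
        · have hadj : K.Adj x u := by
            rw [(Sym2.mem_and_mem_iff (Ne.symm hux)).1 ⟨hxe, hu⟩] at heK
            exact heK
          refine ⟨hxr.trans hadj.reachable, ?_⟩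
          obtain ⟨w, hw⟩ := hxr.exists_walk_length_eq_dist
          have := dist_le (w.concat hadj)
          rw [Walk.length_concat] at this
          omega
      by_cases hc : (ball (k + 1)).card ≤ F.card
      · left
        obtain ⟨x, w, hw, hl⟩ := K.exists_isCycle_length_le_of_card_le v (k + 1) (ball (k + 1))
          (hvb _) (fun u hu => (Finset.mem_filter.1 hu).2) F hF hc
        exact ⟨x, w.mapLe hKH, (Walk.isCycle_mapLe hKH).2 hw, by simpa using hl⟩
      · right
        have : (F.card : ℝ) ≤ (ball (k + 1)).card := by exact_mod_cast (not_le.1 hc).le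
        calc (1 + δ) ^ (k + 1) = (1 + δ) * (1 + δ) ^ k := pow_succ' _ _
          _ ≤ (1 + δ) * (ball k).card := by gcongr
          _ ≤ _ := hFcard.trans this
  refine (key r).imp_right fun h => h.trans ?_
  exact_mod_cast Finset.card_le_univ _

/-- A graph on `n ≥ 2` vertices with a set `S` of vertices spanning at least `(1 + δ)|S|` edges has a
cycle of length `O(log n)`. -/
theorem exists_isCycle_length_le_logb [Fintype V] (H : SimpleGraph V) {δ : ℝ} (hδ : 0 < δ)
    (S : Finset V) (hS : S.Nonempty) (hd : (1 + δ) * S.card ≤ (H.edgesWithin S).card)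
    (hn : 2 ≤ Fintype.card V) :
    ∃ (x : V) (w : H.Walk x x), w.IsCycle ∧
      (w.length : ℝ) ≤ (2 / Real.logb 2 (1 + δ) + 3) * Real.logb 2 (Fintype.card V) := by
  have hn' : (2 : ℝ) ≤ Fintype.card V := by exact_mod_cast hn
  have hL : 0 < Real.logb 2 (1 + δ) := Real.logb_pos one_lt_two (by linarith)
  have hlog : 1 ≤ Real.logb 2 (Fintype.card V) := by
    rw [Real.le_logb_iff_rpow_le one_lt_two (by linarith)]
    simpa using hn'
  set q := Real.logb 2 (Fintype.card V) / Real.logb 2 (1 + δ)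
  have hq : 0 ≤ q := by positivity
  -- The radius exceeds `log n / log (1 + δ)`, so growth up to it would need more than `n` vertices.
  rcases H.exists_isCycle_or_pow_le_card hδ S hS hd (⌊q⌋₊ + 1) with ⟨x, w, hw, hl⟩ | h
  · refine ⟨x, w, hw, ?_⟩
    have h1 : (w.length : ℝ) ≤ 2 * (⌊q⌋₊ + 1) + 1 := by exact_mod_cast hl
    have h2 := Nat.floor_le hq
    calc (w.length : ℝ) ≤ 2 * q + 3 * 1 := by linarith
      _ ≤ 2 * q + 3 * Real.logb 2 (Fintype.card V) := by linarith
      _ = _ := by simp only [q]; ring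
  · exfalso
    have h1 := Real.logb_le_logb_of_le one_lt_two (by positivity) h
    rw [Real.logb_pow, ← le_div_iff₀ hL] at h1
    have h2 := Nat.lt_floor_add_one q
    push_cast at h1
    linarith

end SimpleGraph

/-! ### Avoiding a linear set of vertices -/

theorem IsTwoMatching.exists_notMem {V : Type*} {F : Set (Sym2 V)} (hF : IsTwoMatching F) (v : V) :
    ∃ e ∈ F, v ∉ e := by
  obtain ⟨a, b, x, y, hab, hxy, hax, hay, hbx, hby, rfl⟩ := hF
  by_cases h : v ∈ s(a, b)
  · refine ⟨s(x, y), by simp, ?_⟩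
    rcases Sym2.mem_iff.1 h with rfl | rfl <;> simp [*]
  · exact ⟨s(a, b), by simp, h⟩

theorem IsTriangleEdgeSet.exists_notMem {V : Type*} {F : Set (Sym2 V)} (hF : IsTriangleEdgeSet F)
    (v : V) : ∃ e ∈ F, v ∉ e := by
  obtain ⟨a, b, d, hab, had, hbd, rfl⟩ := hF
  by_cases ha : v = a
  · subst ha
    exact ⟨s(b, d), by simp, by simp [*]⟩
  · by_cases hb : v = b
    · subst hb
      exact ⟨s(a, d), by simp, by simp [*]⟩
    · exact ⟨s(a, b), by simp, by simp [*]⟩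

theorem exists_finset_card_le_four {V : Type*} {F : Set (Sym2 V)}
    (hF : IsTwoMatching F ∨ IsTriangleEdgeSet F) :
    ∃ T : Finset V, T.card ≤ 4 ∧ ∀ e ∈ F, ∀ v ∈ e, v ∈ T := by
  classical
  rcases hF with ⟨a, b, x, y, -, -, -, -, -, -, rfl⟩ | ⟨a, b, d, -, -, -, rfl⟩
  · refine ⟨{a, b, x, y}, Finset.card_le_four, ?_⟩
    rintro e (rfl | rfl) v hv <;> rcases Sym2.mem_iff.1 hv with rfl | rfl <;> simp
  · refine ⟨{a, b, d}, Finset.card_le_three.trans (by norm_num), ?_⟩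
    rintro e (rfl | rfl | rfl) v hv <;> rcases Sym2.mem_iff.1 hv with rfl | rfl <;> simp

/-- A set `U` of points and a family of sets of size at most `k`: if few points of `U` lie in more
than `D` of the sets, then a positive proportion of `U` meets each set at most once. -/
theorem exists_subset_forall_inter_subsingleton {V ι : Type*} (U : Finset V) (A : Finset ι)
    (T : ι → Finset V) (k D : ℕ) (hT : ∀ i ∈ A, (T i).card ≤ k) :
    ∃ W ⊆ U, (∀ i ∈ A, ∀ x ∈ W, ∀ y ∈ W, x ∈ T i → y ∈ T i → x = y) ∧
      (D + 1) * U.card ≤ (D + 1) * ((1 + D * k) * W.card) + k * A.card := by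
  classical
  let deg : V → ℕ := fun v => (A.filter fun i => v ∈ T i).card
  let L := U.filter fun v => deg v ≤ D
  let H := U.filter fun v => ¬ deg v ≤ D
  have hLH : L.card + H.card = U.card := Finset.card_filter_add_card_filter_not _
  -- Double counting of incidences between high-degree points and sets.
  have hH : (D + 1) * H.card ≤ k * A.card := by
    calc (D + 1) * H.card = ∑ _v ∈ H, (D + 1) := by simp [mul_comm]
      _ ≤ ∑ v ∈ H, deg v := Finset.sum_le_sum fun v hv =>
          Nat.succ_le_of_lt (not_le.1 (Finset.mem_filter.1 hv).2)
      _ = ∑ i ∈ A, (H.filter fun v => v ∈ T i).card :=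
          Finset.sum_card_bipartiteAbove_eq_sum_card_bipartiteBelow _
      _ ≤ ∑ _i ∈ A, k := Finset.sum_le_sum fun i hi =>
          (Finset.card_le_card fun v hv => (Finset.mem_filter.1 hv).2).trans (hT i hi)
      _ = k * A.card := by simp [mul_comm]
  let P : Finset (Finset V) := L.powerset.filter fun W =>
    ∀ i ∈ A, ∀ x ∈ W, ∀ y ∈ W, x ∈ T i → y ∈ T i → x = y
  have hP : P.Nonempty := ⟨∅, by simp [P]⟩
  obtain ⟨W, hWP, hmax⟩ := P.exists_max_image Finset.card hP
  obtain ⟨hWL, hW⟩ := Finset.mem_filter.1 hWP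
  rw [Finset.mem_powerset] at hWL
  -- By maximality every low-degree point is in `W` or shares a set with a member of `W`; each
  -- member accounts for at most `1 + D * k` points.
  have hcover : L ⊆ W.biUnion fun w => insert w ((A.filter fun i => w ∈ T i).biUnion T) := by
    intro x hx
    by_contra hxW
    simp only [Finset.mem_biUnion, Finset.mem_insert, Finset.mem_filter, not_exists, not_and,
      not_or] at hxW
    have hxnW : x ∉ W := fun h => (hxW x h).1 rfl
    have hmem : insert x W ∈ P := by
      refine Finset.mem_filter.2 ⟨Finset.mem_powerset.2 (Finset.insert_subset hx hWL), ?_⟩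
      intro i hi a ha b hb hai hbi
      rcases Finset.mem_insert.1 ha with rfl | haW <;> rcases Finset.mem_insert.1 hb with rfl | hbW
      · rfl
      · exact absurd hai ((hxW b hbW).2 i ⟨hi, hbi⟩)
      · exact absurd hbi ((hxW a haW).2 i ⟨hi, hai⟩)
      · exact hW i hi a haW b hbW hai hbi
    have := hmax _ hmem
    rw [Finset.card_insert_of_notMem hxnW] at this
    omega
  have hL : L.card ≤ (1 + D * k) * W.card := by
    rw [mul_comm]
    refine (Finset.card_le_card hcover).trans (Finset.card_biUnion_le_card_mul _ _ _ ?_)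
    intro w hw
    refine (Finset.card_insert_le _ _).trans ?_
    have h1 : ((A.filter fun i => w ∈ T i).biUnion T).card ≤ deg w * k :=
      Finset.card_biUnion_le_card_mul _ _ _ fun i hi => hT i (Finset.mem_filter.1 hi).1
    have h2 : deg w * k ≤ D * k := Nat.mul_le_mul_right _ (Finset.mem_filter.1 (hWL hw)).2
    omega
  refine ⟨W, hWL.trans (Finset.filter_subset _ _), hW, ?_⟩
  calc (D + 1) * U.card = (D + 1) * L.card + (D + 1) * H.card := by rw [← hLH, mul_add]
    _ ≤ _ := Nat.add_le_add (Nat.mul_le_mul_left _ hL) hH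

/-! ### Rainbow cycles from representatives -/

namespace SimpleGraph.EdgeLabeling

variable {V : Type*} {G : SimpleGraph V}

/-- One can choose an edge of each color such that a vertex set `W` of linear size is avoided. -/
theorem exists_transversal_avoiding [Fintype V] [Nonempty V] (c : G.EdgeLabeling ℕ) (D : ℕ) (A : Finset ℕ)
    (B : Finset ℕ) (hB : ∀ i ∈ B, i ∈ c.colors)
    (hA : ∀ i ∈ A, IsTwoMatching (c.colorClass i) ∨ IsTriangleEdgeSet (c.colorClass i)) :
    ∃ (g : ℕ → Sym2 V) (W : Finset V), (∀ i ∈ A ∪ B, g i ∈ c.colorClass i ∧ ∀ v ∈ g i, v ∉ W) ∧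
      (D + 1) * Fintype.card V ≤
        (D + 1) * ((1 + D * 4) * W.card + 2 * B.card) + 4 * A.card := by
  classical
  choose! T hT hTmem using fun i (hi : i ∈ A) => exists_finset_card_le_four (hA i hi)
  have hB' : ∀ i ∈ B, ∃ e, e ∈ c.colorClass i := by
    intro i hi
    obtain ⟨e, he⟩ := hB i hi
    exact ⟨e, e.2, he⟩
  -- Supplies the default value that `choose!` uses for indices outside `B`.
  have : Nonempty (Sym2 V) := ⟨Sym2.diag (Classical.arbitrary V)⟩
  choose! b hb using hB'
  let Z : Finset V := B.biUnion fun i => (b i).toFinset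
  have hZ : Z.card ≤ B.card * 2 := by
    refine Finset.card_biUnion_le_card_mul _ _ _ fun i _ => ?_
    have := Sym2.card_toFinset (b i)
    split_ifs at this <;> omega
  obtain ⟨W, hWU, hW, hcard⟩ := exists_subset_forall_inter_subsingleton (Finset.univ \ Z) A T 4 D hT
  have hex : ∀ i ∈ A ∪ B, ∃ e, e ∈ c.colorClass i ∧ ∀ v ∈ e, v ∉ W := by
    intro i hi
    by_cases hiA : i ∈ A
    · have havoid : ∀ v, ∃ e ∈ c.colorClass i, v ∉ e := fun v =>
        (hA i hiA).elim (fun h => h.exists_notMem v) fun h => h.exists_notMem v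
      by_cases hx : ∃ x ∈ W, x ∈ T i
      · obtain ⟨x, hxW, hxT⟩ := hx
        obtain ⟨e, he, hxe⟩ := havoid x
        refine ⟨e, he, fun v hv hvW => hxe ?_⟩
        rwa [hW i hiA x hxW v hvW hxT (hTmem i hiA e he v hv)]
      · push Not at hx
        obtain ⟨e, he⟩ : ∃ e, e ∈ c.colorClass i := by
          rcases hA i hiA with ⟨p, q, _, _, -, -, -, -, -, -, h⟩ | ⟨p, q, _, -, -, -, h⟩ <;>
            exact ⟨s(p, q), by simp [h]⟩
        exact ⟨e, he, fun v hv hvW => hx v hvW (hTmem i hiA e he v hv)⟩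
    · have hiB : i ∈ B := (Finset.mem_union.1 hi).resolve_left hiA
      refine ⟨b i, hb i hiB, fun v hv hvW => (Finset.mem_sdiff.1 (hWU hvW)).2 ?_⟩
      exact Finset.mem_biUnion.2 ⟨i, hiB, Sym2.mem_toFinset.2 hv⟩
  choose! g hg using hex
  refine ⟨g, W, hg, ?_⟩
  have h1 : Fintype.card V ≤ (Finset.univ \ Z).card + B.card * 2 := by
    have := Finset.card_sdiff_add_card_eq_card (Finset.subset_univ Z)
    rw [Finset.card_univ] at this
    omega
  have h2 := Nat.mul_le_mul_left (D + 1) h1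
  rw [mul_add] at h2 ⊢
  rw [mul_comm 2]
  omega

/-- A system of representatives of `m` colors that is denser than `1 + δ` on some vertex set yields a
rainbow cycle of logarithmic length. -/
theorem exists_isRainbow_isCycle [Fintype V] (c : G.EdgeLabeling ℕ) {δ : ℝ} (hδ : 0 < δ)
    (I : Finset ℕ) (hI : I.Nonempty) (g : ℕ → Sym2 V) (S : Finset V)
    (hg : ∀ i ∈ I, g i ∈ c.colorClass i ∧ ∀ v ∈ g i, v ∈ S)
    (hd : (1 + δ) * S.card ≤ (I.card : ℝ)) (hn : 2 ≤ Fintype.card V) :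
    ∃ (v : V) (w : G.Walk v v), w.IsCycle ∧ c.IsRainbow w.toSubgraph ∧
      (w.length : ℝ) ≤ (2 / Real.logb 2 (1 + δ) + 3) * Real.logb 2 (Fintype.card V) := by
  classical
  let H : SimpleGraph V := fromEdgeSet (g '' I)
  have hHG : H ≤ G := by
    intro a b hab
    obtain ⟨⟨i, hi, he⟩, -⟩ := (fromEdgeSet_adj _).1 hab
    obtain ⟨h, -⟩ := (hg i hi).1
    rwa [he] at h
  have hcol : ∀ i ∈ I, ∀ h : g i ∈ G.edgeSet, c ⟨g i, h⟩ = i := fun i hi _ => (hg i hi).1.2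
  have hinj : Set.InjOn g I := by
    intro i hi j hj hij
    obtain ⟨h, h'⟩ := (hg i hi).1
    obtain ⟨k, k'⟩ := (hg j hj).1
    rw [← h', ← k']
    congr 2
  have hsub : I.image g ⊆ H.edgesWithin S := by
    intro e he
    obtain ⟨i, hi, rfl⟩ := Finset.mem_image.1 he
    refine mem_edgesWithin.2 ⟨?_, (hg i hi).2⟩
    rw [edgeSet_fromEdgeSet]
    exact ⟨⟨i, hi, rfl⟩, G.not_isDiag_of_mem_edgeSet (hg i hi).1.1⟩
  have hcard : (I.card : ℝ) ≤ (H.edgesWithin S).card := by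
    rw [← Finset.card_image_of_injOn hinj]
    exact_mod_cast Finset.card_le_card hsub
  have hS : S.Nonempty := by
    obtain ⟨i, hi⟩ := hI
    exact ⟨_, (hg i hi).2 _ (g i).out_fst_mem⟩
  obtain ⟨x, w, hw, hl⟩ := H.exists_isCycle_length_le_logb hδ S hS (hd.trans hcard) hn
  refine ⟨x, w.mapLe hHG, (Walk.isCycle_mapLe hHG).2 hw, ?_, by simpa using hl⟩
  -- Each edge of the cycle is the representative of its own color, so equal colors force equal
  -- edges.
  have hrep : ∀ e : G.edgeSet, (e : Sym2 V) ∈ (w.mapLe hHG).toSubgraph.edgeSet →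
      g (c e) = e := by
    rintro ⟨e, heG⟩ he
    rw [Walk.mem_edges_toSubgraph, Walk.edges_mapLe_eq_edges] at he
    have := w.edges_subset_edgeSet he
    rw [edgeSet_fromEdgeSet] at this
    obtain ⟨⟨i, hi, rfl⟩, -⟩ := this
    rw [hcol i hi]
  intro e f he hf hef hc
  exact hef (Subtype.ext (by rw [← hrep e he, ← hrep f hf, hc]))

end SimpleGraph.EdgeLabeling

theorem theorem1p6 (α : ℝ) (hα : 1 / 2 < α) :
    ∃ (N₀ : ℕ) (C : ℝ), ∀ (V : Type*) [Fintype V] (G : SimpleGraph V) (c : G.EdgeLabeling ℕ),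
      N₀ ≤ Fintype.card V →
      c.colors.ncard = Fintype.card V →
      α * (Fintype.card V : ℝ) ≤
        (({i ∈ c.colors | IsTwoMatching (c.colorClass i) ∨
          IsTriangleEdgeSet (c.colorClass i)}.ncard : ℕ) : ℝ) →
      ∃ (v : V) (w : G.Walk v v), w.IsCycle ∧ c.IsRainbow w.toSubgraph ∧
        (w.length : ℝ) ≤ C * Real.logb 2 (Fintype.card V : ℝ) := by
  classical
  -- With this `D`, vertices in more than `D` special classes cost at most `(α - 1/2) n`, half of
  -- the available `(2 α - 1) n`.
  obtain ⟨D, hD⟩ := exists_nat_gt (4 / (α - 1 / 2))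
  have hε : 0 < α - 1 / 2 := by linarith
  rw [div_lt_iff₀ hε] at hD
  set δ : ℝ := (α - 1 / 2) / (1 + D * 4) with hδdef
  have hδ : 0 < δ := by positivity
  refine ⟨2, 2 / Real.logb 2 (1 + δ) + 3, ?_⟩
  intro V _ G c hn hcol hgood
  have : Nonempty V := Fintype.card_pos_iff.1 (by omega)
  have hfin : c.colors.Finite := Set.finite_of_ncard_pos (by omega)
  let I := hfin.toFinset
  have hI : I.card = Fintype.card V := by rw [← hcol, Set.ncard_eq_toFinset_card _ hfin]
  let p : ℕ → Prop := fun i => IsTwoMatching (c.colorClass i) ∨ IsTriangleEdgeSet (c.colorClass i)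
  let A := I.filter p
  let B := I.filter fun i => ¬ p i
  have hAB : A.card + B.card = Fintype.card V := by
    rw [← hI]; exact Finset.card_filter_add_card_filter_not _
  have hunion : A ∪ B = I := Finset.filter_union_filter_not_eq _ _
  have hA : α * (Fintype.card V : ℝ) ≤ A.card := by
    have : {i ∈ c.colors | p i} = (A : Set ℕ) := by ext i; simp [A, I]
    change α * (Fintype.card V : ℝ) ≤ (({i ∈ c.colors | p i}.ncard : ℕ) : ℝ) at hgood
    rwa [this, Set.ncard_coe_finset] at hgood
  obtain ⟨g, W, hg, hcard⟩ := c.exists_transversal_avoiding D A B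
    (fun i hi => hfin.mem_toFinset.1 (Finset.mem_filter.1 hi).1)
    (fun i hi => (Finset.mem_filter.1 hi).2)
  rw [hunion] at hg
  refine c.exists_isRainbow_isCycle hδ I (Finset.card_pos.1 (by omega)) g (Finset.univ \ W)
    (fun i hi => ⟨(hg i hi).1, fun v hv => by simpa using (hg i hi).2 v hv⟩) ?_ hn
  have hWc : (((Finset.univ \ W).card : ℕ) : ℝ) = Fintype.card V - W.card := by
    have h := Finset.card_sdiff_add_card_eq_card (Finset.subset_univ W)
    rw [Finset.card_univ] at h
    rw [← h]; push_cast; ring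
  rw [hI, hWc]
  set n : ℝ := (Fintype.card V : ℝ) with hn_def
  have hn0 : 0 ≤ n := Nat.cast_nonneg _
  have hAB' : (A.card : ℝ) + B.card = n := by rw [hn_def]; exact_mod_cast hAB
  have hcard' : ((D : ℝ) + 1) * n ≤ (D + 1) * ((1 + D * 4) * W.card + 2 * B.card) + 4 * A.card := by
    rw [hn_def]; exact_mod_cast hcard
  have hδW : δ * n ≤ W.card := by
    rw [hδdef, div_mul_eq_mul_div, div_le_iff₀ (by positivity)]
    have hBn : (B.card : ℝ) ≤ (1 - α) * n := by linarith
    have hB0 : (0 : ℝ) ≤ B.card := Nat.cast_nonneg _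
    have hD1 : (0 : ℝ) < (D : ℝ) + 1 := by positivity
    have h1 : 4 * (A.card : ℝ) ≤ (D + 1) * ((α - 1 / 2) * n) := by nlinarith
    have h2 : ((D : ℝ) + 1) * n ≤
        (D + 1) * ((1 + D * 4) * W.card + 2 * B.card + (α - 1 / 2) * n) := by linarith
    have h3 := le_of_mul_le_mul_left h2 hD1
    linarith
  -- Since `|W| ≥ δ n`, the claim reduces to `(1 + δ)(1 - δ) ≤ 1`.
  nlinarith [mul_le_mul_of_nonneg_left hδW hδ.le, mul_nonneg (sq_nonneg δ) hn0]
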